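/- Consider the broadcasting process on the infinite rooted $d$-ary tree with state space $\{1,2\}$ and channel $$\mathbf M=\frac12\left[\begin{pmatrix}1+\theta&1-\theta\\1-\theta&1+\theta\end{pmatrix}+\Delta\begin{pmatrix}-1&1\\-1&1\end{pmatrix}\right],\qquad |\theta|+|\Delta|\le 1,$$ that is, given the spins of generation $n$, the spins of generation $n+1$ are independent and a vertex whose parent has spin $i$ has spin $j$ with probability $M_{ij}$. Let $\sigma^i(n)$ be the spins of generation $n$ conditioned on the root having spin $i$. The model has non-reconstruction if $\limsup_{n\to\infty}d_{TV}(\sigma^i(n),\sigma^j(n))=0$ for all states $i,j$. For every probability vector $\pi=(\pi_1,\pi_2)$ there is a $D=D(\pi)>0$ such that the following holds for every integer $d>D$ and all $\theta,\Delta$ with $|\theta|+|\Delta|\le1$ for which $\pi$ is a stationary distribution of $\mathbf M$ and $\Delta^2<(1-\theta)^2/3$ (equivalently, $\theta\neq 1$ and $1-6\pi_1\pi_2<0$). The Kesten–Stigum bound is sharp: there is non-reconstruction whenever $d\theta^2<1$. Furthermore, there is non-reconstruction at the Kesten–Stigum bound $d\theta^2=1$. -/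

import Mathlib

open Filter

noncomputable section

namespace TreeBroadcast

/-- The vertices at distance `n` from the root of the infinite rooted `d`-ary tree: a vertex is
addressed by the word of the `n` choices of a child that lead from the root to it. The only vertex
with `n = 0` is the root. -/
abbrev Level (d n : ℕ) : Type := Fin n → Fin d

/-- The parent of a vertex of generation `n + 1`: its address without the last letter. -/
def parent {d n : ℕ} (v : Level d (n + 1)) : Level d n := Fin.init v

/-- The law of the spins of generation `n` of the broadcasting process with channel `M` on the
`d`-ary tree, conditioned on the root having spin `i`: `levelLaw M d i n A` is the probability that
`σ(n) = A`. The root has spin `i`; given generation `n`, the spins of generation `n + 1` are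
independent, and the spin of `v` equals `j` with probability `M (spin of the parent of v) j`. -/
def levelLaw {C : Type*} [Fintype C] [DecidableEq C] (M : Matrix C C ℝ) (d : ℕ) (i : C) :
    (n : ℕ) → (Level d n → C) → ℝ
  | 0, A => if A Fin.elim0 = i then 1 else 0
  | n + 1, A => ∑ B : Level d n → C,
      levelLaw M d i n B * ∏ v : Level d (n + 1), M (B (parent v)) (A v)

/-- The total variation distance of two probability mass functions on a finite set. -/
def tvDist {S : Type*} [Fintype S] (p q : S → ℝ) : ℝ := (∑ a, |p a - q a|) / 2

/-- Non-reconstruction for the channel `M` on the `d`-ary tree: the limsup of the total variation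
distance of `σⁱ(n)` and `σʲ(n)` is zero, for all states `i`, `j`. -/
def NonReconstruction {C : Type*} [Fintype C] [DecidableEq C] (M : Matrix C C ℝ) (d : ℕ) : Prop :=
  ∀ i j : C, limsup (fun n : ℕ => tvDist (levelLaw M d i n) (levelLaw M d j n)) atTop = 0

/-- The asymmetric binary channel with second eigenvalue `θ` and asymmetry `Δ`. The states `1`, `2`
are the elements `0`, `1` of `Fin 2`. -/
def binaryChannel (θ Δ : ℝ) : Matrix (Fin 2) (Fin 2) ℝ :=
  (1 / 2 : ℝ) • (!![1 + θ, 1 - θ; 1 - θ, 1 + θ] + Δ • !![-1, 1; -1, 1])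

/-- `π` is a stationary distribution of `M`: a probability vector with `π M = π`. -/
def IsStationary {C : Type*} [Fintype C] (π : C → ℝ) (M : Matrix C C ℝ) : Prop :=
  π ∈ stdSimplex ℝ C ∧ Matrix.vecMul π M = π

end TreeBroadcast

end

/-!
Write `q = π₁ π₂`; stationarity and the bound on `Δ` give `6 q > 1`. Let `xₙ` be the chi-square
distance of the two conditional laws of generation `n`, relative to their stationary mixture. It
dominates the square of the total variation distance, so it suffices that `xₙ → 0`.

Given the spin of the root, the `d` subtrees of its children are independent, and each is a copy of
the tree of depth `n` seen through the channel once more. Reveal them one at a time and follow the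
posterior probability `p` of the first root spin. It is a martingale started at `π₁`, and `q² xₙ₊₁`
is the mean of `(p - π₁)²` after `d` steps, that is, the sum of the mean squared increments. Each
increment has, to leading order, the conditional variance `τ V²`, with `V = p (1 - p)` and
`τ = θ² xₙ`. At the start `V = q`, so if `E V²` did not change, one would find `xₙ₊₁ = d θ² xₙ`.

In fact `E V²` decreases. To leading order a step changes it by `τ E[V² (1 - 6 V)]`, and by
convexity of `x ↦ x^(3/2)` this pulls `E V²` below `q²` as soon as `6 q > 1`. Quantitatively, the
function `V² + c (p - π₁)²` has mean at most `q²` at all times, for a small `c > 0`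
(`observe_potential_le`, `observe_pow_potential_le`). The error terms are of relative size `|θ|`,
hence small for large `d`, since `d θ² ≤ 1`. The one third-moment term which is not dominated by
`(p - π₁)²` is a multiple of `p - π₁`, with mean zero (`weighted_deviation_sq_le`). So the
expected squared increments are at most `τ (q² - (c / 2) E (p - π₁)²)`, and summing them gives
`xₙ₊₁ ≤ d θ² xₙ - (c / 2) (θ² xₙ)²` (`observe_pow_deviation_sq_le`, `chiSq_children_le`). This
forces `xₙ → 0` for `d θ² ≤ 1`, with equality included. No Gaussian approximation is needed.
-/

noncomputable section

namespace TreeBroadcast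

/-! ### Bayesian updating of the belief about the root -/

section Posterior

variable {S : Type*} [Fintype S]

/-- The posterior probability that the root has the first spin, when its probability was `p` before
one more child subtree is observed. The observation enters through the number `t`: its density
relative to the stationary law is `1 + (1 - a) * t` or `1 - a * t`, according to the spin of the
root, where `a` is the stationary probability of the first spin. The denominator `1 + (p - a) * t`
is the density of the observation under the current belief `p`. -/
def bayes (a p t : ℝ) : ℝ := p + p * (1 - p) * t / (1 + (p - a) * t)

theorem weight_ge_half {a p t : ℝ} (ha : a ∈ Set.Icc (0 : ℝ) 1) (hp : p ∈ Set.Icc (0 : ℝ) 1)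
    (ht : |t| ≤ 1 / 2) : 1 / 2 ≤ 1 + (p - a) * t := by
  have h1 : |p - a| ≤ 1 := abs_le.2 ⟨by linarith [ha.2, hp.1], by linarith [ha.1, hp.2]⟩
  have h2 : |(p - a) * t| ≤ 1 * (1 / 2) := by
    rw [abs_mul]
    exact mul_le_mul h1 ht (abs_nonneg _) zero_le_one
  linarith [(abs_le.1 h2).1]

theorem weight_mul_bayes {a p t : ℝ} (hw : 1 + (p - a) * t ≠ 0) :
    (1 + (p - a) * t) * bayes a p t = p * (1 + (1 - a) * t) := by
  unfold bayes
  field_simp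
  ring

theorem weight_mul_one_sub_bayes {a p t : ℝ} (hw : 1 + (p - a) * t ≠ 0) :
    (1 + (p - a) * t) * (1 - bayes a p t) = (1 - p) * (1 - a * t) := by
  rw [mul_sub, weight_mul_bayes hw]
  ring

theorem bayes_mem_Icc {a p t : ℝ} (ha : a ∈ Set.Icc (0 : ℝ) 1) (hp : p ∈ Set.Icc (0 : ℝ) 1)
    (ht : |t| ≤ 1 / 2) : bayes a p t ∈ Set.Icc (0 : ℝ) 1 := by
  have hw := weight_ge_half ha hp ht
  have hw0 : 0 < 1 + (p - a) * t := by linarith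
  have h1 := weight_ge_half ha ⟨zero_le_one, le_rfl⟩ ht
  have h2 := weight_ge_half ha ⟨le_rfl, zero_le_one⟩ ht
  have e1 := weight_mul_bayes hw0.ne'
  have e2 := weight_mul_one_sub_bayes hw0.ne'
  constructor
  · refine nonneg_of_mul_nonneg_right (a := 1 + (p - a) * t) ?_ hw0
    rw [e1]
    exact mul_nonneg hp.1 (by linarith)
  · have : 0 ≤ 1 - bayes a p t := by
      refine nonneg_of_mul_nonneg_right (a := 1 + (p - a) * t) ?_ hw0
      rw [e2]
      exact mul_nonneg (by linarith [hp.2]) (by linarith)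
    linarith

/-- Second order expansion, in the observation `t`, of the square of the variance `P * (1 - P)` of
the updated belief `P`, weighted by the density of the observation. The coefficient of the quadratic
term has the negative part `-6 * (p * (1 - p))`, which wins for `p` near `a` exactly if
`6 * a * (1 - a) > 1`. -/
theorem weighted_variance_sq_le {a p t : ℝ} (ha : a ∈ Set.Icc (0 : ℝ) 1)
    (hp : p ∈ Set.Icc (0 : ℝ) 1) (ht : |t| ≤ 1 / 2) :
    (1 + (p - a) * t) * (bayes a p t * (1 - bayes a p t)) ^ 2 ≤
      (p * (1 - p)) ^ 2 * (1 + (2 * (1 - 2 * a) - 3 * (p - a)) * t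
        + (1 - 6 * (p * (1 - p))) * t ^ 2 + 720 * (|t| * t ^ 2)) := by
  have hw := weight_ge_half ha hp ht
  have hw0 : 0 < 1 + (p - a) * t := by linarith
  have e1 := weight_mul_bayes hw0.ne'
  have e2 := weight_mul_one_sub_bayes hw0.ne'
  obtain ⟨m, rfl⟩ : ∃ m, p = a + m := ⟨p - a, by ring⟩
  simp only [add_sub_cancel_left] at *
  set P := bayes a (a + m) t
  set w := 1 + m * t with hwdef
  have hm : |m| ≤ 1 := abs_le.2 ⟨by linarith [ha.2, hp.1], by linarith [ha.1, hp.2]⟩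
  set g := 1 - 2 * a with hg
  set q := a * (1 - a) with hq
  have hg1 : |g| ≤ 1 := abs_le.2 ⟨by linarith [ha.2], by linarith [ha.1]⟩
  have hq1 : |q| ≤ 1 / 4 :=
    abs_le.2 ⟨by nlinarith [ha.1, ha.2], by nlinarith [sq_nonneg (a - 1 / 2)]⟩
  set k := 1 - 6 * ((a + m) * (1 - (a + m))) with hk
  have hk1 : |k| ≤ 1 := abs_le.2 ⟨by nlinarith [sq_nonneg (a + m - 1 / 2)],
    by nlinarith [mul_nonneg hp.1 (sub_nonneg.2 hp.2)]⟩
  set b := 2 * g - 3 * m with hb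
  have hb1 : |b| ≤ 5 := by
    have := abs_sub (2 * g) (3 * m)
    rw [abs_mul, abs_mul, abs_of_pos (by norm_num : (0 : ℝ) < 2),
      abs_of_pos (by norm_num : (0 : ℝ) < 3)] at this
    linarith
  -- the remainder after the terms of order two in `t`
  set R := (m ^ 3 + 3 * m ^ 2 * b + 3 * m * k + 2 * g * q)
    + t * (m ^ 3 * b + 3 * m ^ 2 * k - q ^ 2) + t ^ 2 * (m ^ 3 * k) with hR
  have key : (w * P * (w * (1 - P))) ^ 2
      = ((a + m) * (1 - (a + m))) ^ 2 * (w ^ 3 * (1 + b * t + k * t ^ 2) - t ^ 3 * R) := by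
    rw [e1, e2, hR, hb, hk, hq, hg, hwdef]
    ring
  have hR1 : |R| ≤ 90 := by
    calc |R| ≤ (|m| ^ 3 + 3 * |m| ^ 2 * |b| + 3 * |m| * |k| + 2 * |g| * |q|)
          + |t| * (|m| ^ 3 * |b| + 3 * |m| ^ 2 * |k| + |q| ^ 2) + |t| ^ 2 * (|m| ^ 3 * |k|) := by
          have hx := abs_add_three (m ^ 3 + 3 * m ^ 2 * b + 3 * m * k + 2 * g * q)
            (t * (m ^ 3 * b + 3 * m ^ 2 * k - q ^ 2)) (t ^ 2 * (m ^ 3 * k))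
          have hy := abs_add_le (m ^ 3 + 3 * m ^ 2 * b + 3 * m * k) (2 * g * q)
          have hz := abs_add_three (m ^ 3) (3 * m ^ 2 * b) (3 * m * k)
          have hu := abs_sub (m ^ 3 * b + 3 * m ^ 2 * k) (q ^ 2)
          have hv := abs_add_le (m ^ 3 * b) (3 * m ^ 2 * k)
          have huv := mul_le_mul_of_nonneg_left (hu.trans (add_le_add_left hv _)) (abs_nonneg t)
          simp only [abs_mul, abs_pow, Nat.abs_ofNat] at hx hy hz hu hv huv
          linarith
      _ ≤ (1 ^ 3 + 3 * 1 ^ 2 * 5 + 3 * 1 * 1 + 2 * 1 * (1 / 4))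
          + 1 / 2 * (1 ^ 3 * 5 + 3 * 1 ^ 2 * 1 + (1 / 4) ^ 2) + (1 / 2) ^ 2 * (1 ^ 3 * 1) := by
          gcongr
      _ ≤ 90 := by norm_num
  have h3 : -(t ^ 3 * R) ≤ 90 * (|t| * t ^ 2) := by
    calc -(t ^ 3 * R) ≤ |t ^ 3 * R| := neg_le_abs _
      _ = |t| ^ 3 * |R| := by rw [abs_mul, abs_pow]
      _ ≤ |t| ^ 3 * 90 := by gcongr
      _ = 90 * (|t| * t ^ 2) := by rw [← sq_abs t]; ring
  have hw3 : (1 / 2) ^ 3 ≤ w ^ 3 := by gcongr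
  have hT : 0 ≤ |t| * t ^ 2 := by positivity
  have h4 : w ^ 3 * (1 + b * t + k * t ^ 2) - t ^ 3 * R
      ≤ w ^ 3 * (1 + b * t + k * t ^ 2 + 720 * (|t| * t ^ 2)) := by
    linarith [mul_le_mul_of_nonneg_right hw3 hT]
  have h5 : w ^ 3 * (w * (P * (1 - P)) ^ 2) ≤ w ^ 3 * (((a + m) * (1 - (a + m))) ^ 2 *
      (1 + b * t + k * t ^ 2 + 720 * (|t| * t ^ 2))) := by
    calc w ^ 3 * (w * (P * (1 - P)) ^ 2) = (w * P * (w * (1 - P))) ^ 2 := by ring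
      _ = _ := key
      _ ≤ ((a + m) * (1 - (a + m))) ^ 2 *
          (w ^ 3 * (1 + b * t + k * t ^ 2 + 720 * (|t| * t ^ 2))) := by gcongr
      _ = _ := by ring
  exact le_of_mul_le_mul_left h5 (by positivity)

theorem weight_mul_deviation {a p t : ℝ} (hw : 1 + (p - a) * t ≠ 0) :
    (1 + (p - a) * t) * (bayes a p t - a) = (p - a) + ((p - a) * (p - a) + p * (1 - p)) * t := by
  rw [mul_sub, weight_mul_bayes hw]
  ring

theorem weighted_deviation_sq {a p t : ℝ} (hw : 1 + (p - a) * t ≠ 0) :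
    (1 + (p - a) * t) * (bayes a p t - a) ^ 2 = (p - a) ^ 2 * (1 + (p - a) * t)
      + 2 * (p - a) * (p * (1 - p)) * t + (p * (1 - p)) ^ 2 * (t ^ 2 / (1 + (p - a) * t)) := by
  have h : bayes a p t - a = (p - a) + p * (1 - p) * t / (1 + (p - a) * t) := by
    unfold bayes; ring
  rw [h]
  field_simp
  ring

/-- Upper bound of order two for the squared deviation of the updated belief from `a`, with a lossy
factor `2` on the increment. -/
theorem weighted_deviation_sq_le_crude {a p t : ℝ} (ha : a ∈ Set.Icc (0 : ℝ) 1)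
    (hp : p ∈ Set.Icc (0 : ℝ) 1) (ht : |t| ≤ 1 / 2) :
    (1 + (p - a) * t) * (bayes a p t - a) ^ 2 ≤ (p - a) ^ 2 * (1 + (p - a) * t)
      + 2 * (p - a) * (p * (1 - p)) * t + (p * (1 - p)) ^ 2 * (2 * t ^ 2) := by
  have hw := weight_ge_half ha hp ht
  have hw0 : 0 < 1 + (p - a) * t := by linarith
  rw [weighted_deviation_sq hw0.ne']
  have : t ^ 2 / (1 + (p - a) * t) ≤ 2 * t ^ 2 := by
    rw [div_le_iff₀ hw0]
    nlinarith [sq_nonneg t]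
  gcongr

/-- Expansion to order three of the squared deviation of the updated belief from `a`. The cubic term
has no sign and is too large to be discarded, but it is linear in `p - a` up to a quadratic error;
as the belief is a martingale started at `a`, the linear part averages to zero. -/
theorem weighted_deviation_sq_le {a p t : ℝ} (ha : a ∈ Set.Icc (0 : ℝ) 1)
    (hp : p ∈ Set.Icc (0 : ℝ) 1) (ht : |t| ≤ 1 / 2) :
    (1 + (p - a) * t) * (bayes a p t - a) ^ 2 ≤ (p - a) ^ 2 * (1 + (p - a) * t)
      + 2 * (p - a) * (p * (1 - p)) * t + (p * (1 - p)) ^ 2 * t ^ 2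
      - (a * (1 - a)) ^ 2 * (p - a) * t ^ 3 + 2 * (p - a) ^ 2 * (|t| * t ^ 2) := by
  have hw := weight_ge_half ha hp ht
  have hw0 : 0 < 1 + (p - a) * t := by linarith
  rw [weighted_deviation_sq hw0.ne']
  have hV0 : 0 ≤ p * (1 - p) := mul_nonneg hp.1 (sub_nonneg.2 hp.2)
  have hV1 : p * (1 - p) ≤ 1 / 4 := by nlinarith [sq_nonneg (p - 1 / 2)]
  have hq0 : 0 ≤ a * (1 - a) := mul_nonneg ha.1 (sub_nonneg.2 ha.2)
  have hq1 : a * (1 - a) ≤ 1 / 4 := by nlinarith [sq_nonneg (a - 1 / 2)]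
  have ht0 := abs_nonneg t
  have hT : 0 ≤ |t| * t ^ 2 := by positivity
  have e1 : t ^ 2 / (1 + (p - a) * t)
      = t ^ 2 - (p - a) * t ^ 3 + (p - a) ^ 2 * (t ^ 4 / (1 + (p - a) * t)) := by
    rw [div_eq_iff hw0.ne', add_mul, mul_assoc ((p - a) ^ 2), div_mul_cancel₀ _ hw0.ne']
    ring
  have e2 : t ^ 4 / (1 + (p - a) * t) ≤ |t| * t ^ 2 := by
    rw [div_le_iff₀ hw0]
    have : t ^ 4 = |t| * (|t| * t ^ 2) := by
      rw [← sq_abs t, show t ^ 4 = (t ^ 2) ^ 2 by ring, ← sq_abs t]; ring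
    rw [this, mul_comm]
    exact mul_le_mul_of_nonneg_left (ht.trans hw) hT
  have e3 : (p * (1 - p)) ^ 2 * ((p - a) ^ 2 * (t ^ 4 / (1 + (p - a) * t)))
      ≤ 1 * ((p - a) ^ 2 * (|t| * t ^ 2)) := by
    gcongr
    nlinarith
  -- the coefficient `V² (p - a)` differs from its multiple `q² (p - a)` by a multiple of `(p - a)²`
  have e4 : -((p * (1 - p)) ^ 2 * ((p - a) * t ^ 3)) ≤ -((a * (1 - a)) ^ 2 * (p - a) * t ^ 3)
      + (p - a) ^ 2 * (|t| * t ^ 2) := by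
    have h1 : (a * (1 - a)) ^ 2 * (p - a) * t ^ 3 - (p * (1 - p)) ^ 2 * ((p - a) * t ^ 3)
        = (p - a) ^ 2 * (t ^ 3 * ((p + a - 1) * (p * (1 - p) + a * (1 - a)))) := by ring
    have h2 : t ^ 3 * ((p + a - 1) * (p * (1 - p) + a * (1 - a))) ≤ |t| * t ^ 2 := by
      have h3 : |(p + a - 1) * (p * (1 - p) + a * (1 - a))| ≤ 1 * 1 := by
        rw [abs_mul]
        refine mul_le_mul (abs_le.2 ⟨by linarith [hp.1, ha.1], by linarith [hp.2, ha.2]⟩)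
          (abs_le.2 ⟨by linarith, by linarith⟩) (abs_nonneg _) zero_le_one
      calc _ ≤ |t ^ 3 * ((p + a - 1) * (p * (1 - p) + a * (1 - a)))| := le_abs_self _
        _ = |t| ^ 3 * |(p + a - 1) * (p * (1 - p) + a * (1 - a))| := by rw [abs_mul, abs_pow]
        _ ≤ |t| ^ 3 * (1 * 1) := by gcongr
        _ = |t| * t ^ 2 := by rw [← sq_abs t]; ring
    have := mul_le_mul_of_nonneg_left h2 (sq_nonneg (p - a))
    linarith
  rw [e1]
  linarith

/-- The Markov operator of one observation: `observe μ t a F p` is the expectation of `F` at the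
belief updated from `p`. Observations `s` have law `μ` under the stationary distribution and
likelihood parameter `t s`, as in `bayes`. Its powers describe several conditionally independent
observations. -/
def observe (μ t : S → ℝ) (a : ℝ) : Module.End ℝ (ℝ → ℝ) where
  toFun F p := ∑ s, μ s * ((1 + (p - a) * t s) * F (bayes a p (t s)))
  map_add' F G := by
    ext p
    simp only [Pi.add_apply, ← Finset.sum_add_distrib]
    exact Finset.sum_congr rfl fun s _ => by ring
  map_smul' r F := by
    ext p
    simp only [Pi.smul_apply, smul_eq_mul, RingHom.id_apply, Finset.mul_sum]
    exact Finset.sum_congr rfl fun s _ => by ring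

theorem observe_apply (μ t : S → ℝ) (a : ℝ) (F : ℝ → ℝ) (p : ℝ) :
    observe μ t a F p = ∑ s, μ s * ((1 + (p - a) * t s) * F (bayes a p (t s))) := rfl

/-- The conditions under which `μ` and `t` describe a single observation whose likelihood parameter
is bounded by `ε`: `μ` is a probability, and `t` has mean zero. -/
structure IsObservation (μ t : S → ℝ) (a ε : ℝ) : Prop where
  prior : a ∈ Set.Icc (0 : ℝ) 1
  nonneg : ∀ s, 0 ≤ μ s
  sum_eq_one : ∑ s, μ s = 1
  sum_mul : ∑ s, μ s * t s = 0
  abs_le : ∀ s, |t s| ≤ ε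
  le_half : ε ≤ 1 / 2

variable {μ t : S → ℝ} {a ε : ℝ}

theorem IsObservation.abs_le_half (h : IsObservation μ t a ε) (s : S) : |t s| ≤ 1 / 2 :=
  (h.abs_le s).trans h.le_half

theorem observe_pow_mono (h : IsObservation μ t a ε) {F G : ℝ → ℝ}
    (hFG : ∀ p ∈ Set.Icc (0 : ℝ) 1, F p ≤ G p) (k : ℕ) :
    ∀ p ∈ Set.Icc (0 : ℝ) 1, (observe μ t a ^ k) F p ≤ (observe μ t a ^ k) G p := by
  induction k with
  | zero => simpa using hFG
  | succ k ih =>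
    intro p hp
    rw [pow_succ', Module.End.mul_apply, Module.End.mul_apply, observe_apply, observe_apply]
    refine Finset.sum_le_sum fun s _ => mul_le_mul_of_nonneg_left
      (mul_le_mul_of_nonneg_left (ih _ (bayes_mem_Icc h.prior hp (h.abs_le_half s))) ?_)
      (h.nonneg s)
    linarith [weight_ge_half h.prior hp (h.abs_le_half s)]

theorem sum_quadratic (h : IsObservation μ t a ε) (A B C : ℝ) :
    ∑ s, μ s * (A + B * t s + C * t s ^ 2) = A + C * ∑ s, μ s * t s ^ 2 := by
  calc ∑ s, μ s * (A + B * t s + C * t s ^ 2)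
      = A * ∑ s, μ s + B * ∑ s, μ s * t s + C * ∑ s, μ s * t s ^ 2 := by
        simp only [Finset.mul_sum, ← Finset.sum_add_distrib]
        exact Finset.sum_congr rfl fun s _ => by ring
    _ = _ := by rw [h.sum_eq_one, h.sum_mul]; ring

theorem observe_le_of_quadratic (h : IsObservation μ t a ε) {F : ℝ → ℝ} {p A B C : ℝ}
    (hF : ∀ s, (1 + (p - a) * t s) * F (bayes a p (t s)) ≤ A + B * t s + C * t s ^ 2) :
    observe μ t a F p ≤ A + C * ∑ s, μ s * t s ^ 2 := by
  rw [← sum_quadratic h A B C, observe_apply]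
  exact Finset.sum_le_sum fun s _ => mul_le_mul_of_nonneg_left (hF s) (h.nonneg s)

theorem abs_mul_sq_le (h : IsObservation μ t a ε) (s : S) : |t s| * t s ^ 2 ≤ ε * t s ^ 2 :=
  mul_le_mul_of_nonneg_right (h.abs_le s) (sq_nonneg _)

/-! ### Moments of the belief after several observations -/

theorem observe_one (h : IsObservation μ t a ε) :
    observe μ t a (fun _ => 1) = fun _ => 1 := by
  ext p
  rw [observe_apply]
  have := sum_quadratic h 1 (p - a) 0
  simp only [zero_mul, add_zero] at this
  simpa using this

theorem observe_pow_one (h : IsObservation μ t a ε) (k : ℕ) :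
    (observe μ t a ^ k) (fun _ => 1) = fun _ => 1 := by
  induction k with
  | zero => simp
  | succ k ih => rw [pow_succ, Module.End.mul_apply, observe_one h, ih]

/-- The belief is a martingale. -/
theorem observe_deviation (h : IsObservation μ t a ε) {p : ℝ} (hp : p ∈ Set.Icc (0 : ℝ) 1) :
    observe μ t a (fun p => p - a) p = p - a := by
  have := sum_quadratic h (p - a) ((p - a) * (p - a) + p * (1 - p)) 0
  simp only [zero_mul, add_zero] at this
  rw [observe_apply]
  refine Eq.trans ?_ this
  refine Finset.sum_congr rfl fun s _ => ?_
  rw [weight_mul_deviation]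
  linarith [weight_ge_half h.prior hp (h.abs_le_half s)]

theorem observe_pow_deviation (h : IsObservation μ t a ε) (k : ℕ) :
    (observe μ t a ^ k) (fun p => p - a) a = 0 := by
  induction k with
  | zero => simp
  | succ k ih =>
    rw [pow_succ, Module.End.mul_apply]
    apply le_antisymm
    · exact (observe_pow_mono h (fun p hp => (observe_deviation h hp).le) k a h.prior).trans ih.le
    · exact ih.ge.trans (observe_pow_mono h (fun p hp => (observe_deviation h hp).ge) k a h.prior)

/-- The Lyapunov function of the belief: its squared variance plus a small multiple of its squared
deviation from `a`. -/
def potential (a c p : ℝ) : ℝ := (p * (1 - p)) ^ 2 + c * (p - a) ^ 2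

/-- The weight of the squared deviation in the Lyapunov function, in terms of `q = a * (1 - a)`.
It is positive for `6 * q > 1`; the factor `1 / 8` is small enough for `observe_potential_le`. -/
def gain (q : ℝ) : ℝ := q ^ 2 * (6 * q - 1) / 8

theorem gain_pos {q : ℝ} (hq : 1 / 6 < q) : 0 < gain q := by
  have : 0 < q ^ 2 * (6 * q - 1) := mul_pos (by positivity) (by linarith)
  rw [gain]
  linarith

/-- One observation raises the mean of the Lyapunov function by at most a small positive multiple of
what it lacks to its initial value `(a * (1 - a)) ^ 2`, so its mean never exceeds that value. -/
theorem observe_potential_le (h : IsObservation μ t a ε) (hq : 1 / 6 < a * (1 - a))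
    (hε : 720 * ε ≤ gain (a * (1 - a))) {p : ℝ} (hp : p ∈ Set.Icc (0 : ℝ) 1) :
    observe μ t a (potential a (gain (a * (1 - a)))) p ≤ potential a (gain (a * (1 - a))) p
      + (9 * (a * (1 - a)) - 1 - 3 * gain (a * (1 - a))) * (∑ s, μ s * t s ^ 2)
        * ((a * (1 - a)) ^ 2 - potential a (gain (a * (1 - a))) p) := by
  have hτ : 0 ≤ ∑ s, μ s * t s ^ 2 :=
    Finset.sum_nonneg fun s _ => mul_nonneg (h.nonneg s) (sq_nonneg _)
  set τ := ∑ s, μ s * t s ^ 2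
  have hq4 : a * (1 - a) ≤ 1 / 4 := by nlinarith [sq_nonneg (a - 1 / 2)]
  set q := a * (1 - a)
  set c := gain q with hc
  have hcq : q ^ 2 * (6 * q - 1) = 8 * c := by rw [hc, gain]; ring
  have hc0 : 0 < c := gain_pos hq
  have h1 : observe μ t a (potential a c) p ≤ potential a c p
      + (p * (1 - p)) ^ 2 * (1 - 6 * (p * (1 - p)) + 3 * c) * τ := by
    refine observe_le_of_quadratic h (B := (p * (1 - p)) ^ 2 * (2 * (1 - 2 * a) - 3 * (p - a))
      + c * ((p - a) ^ 2 * (p - a) + 2 * (p - a) * (p * (1 - p)))) fun s => ?_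
    have e1 := weighted_variance_sq_le h.prior hp (h.abs_le_half s)
    have e2 := weighted_deviation_sq_le_crude h.prior hp (h.abs_le_half s)
    have e3 : (p * (1 - p)) ^ 2 * (720 * (|t s| * t s ^ 2))
        ≤ (p * (1 - p)) ^ 2 * (c * t s ^ 2) := by
      have := abs_mul_sq_le h s
      have : 720 * (|t s| * t s ^ 2) ≤ c * t s ^ 2 := by nlinarith [sq_nonneg (t s)]
      gcongr
    have e4 := mul_le_mul_of_nonneg_left e2 hc0.le
    unfold potential
    linarith
  refine h1.trans ?_
  have hV0 : 0 ≤ p * (1 - p) := mul_nonneg hp.1 (sub_nonneg.2 hp.2)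
  set V := p * (1 - p)
  have hm : (p - a) ^ 2 ≤ 1 := by
    rw [sq_le_one_iff_abs_le_one]
    exact abs_le.2 ⟨by linarith [h.prior.2, hp.1], by linarith [h.prior.1, hp.2]⟩
  -- convexity of `x ↦ x ^ (3 / 2)` at `q²`, applied to `V²`
  have hconv : 0 ≤ (V - q) ^ 2 * (2 * V + q) := by positivity
  have hA0 : 0 ≤ 9 * q - 1 - 3 * c := by nlinarith
  have hA2 : 9 * q - 1 - 3 * c ≤ 2 := by linarith
  have h2 : V ^ 2 * (1 - 6 * V + 3 * c)
      ≤ (9 * q - 1 - 3 * c) * (q ^ 2 - (V ^ 2 + c * (p - a) ^ 2)) := by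
    have h3 : (9 * q - 1 - 3 * c) * (c * (p - a) ^ 2) ≤ 2 * (c * 1) := by gcongr
    have h4 : q ^ 2 * c ≤ 1 * c := by gcongr; nlinarith
    linarith
  have h5 := mul_le_mul_of_nonneg_right h2 hτ
  unfold potential
  linarith

theorem sum_mul_sq_le (h : IsObservation μ t a ε) : ∑ s, μ s * t s ^ 2 ≤ 1 / 4 := by
  calc ∑ s, μ s * t s ^ 2 ≤ ∑ s, μ s * (1 / 4) := by
        refine Finset.sum_le_sum fun s _ => mul_le_mul_of_nonneg_left ?_ (h.nonneg s)
        rw [← sq_abs]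
        nlinarith [h.abs_le_half s, abs_nonneg (t s)]
    _ = 1 / 4 := by rw [← Finset.sum_mul, h.sum_eq_one, one_mul]

theorem observe_pow_potential_le (h : IsObservation μ t a ε) (hq : 1 / 6 < a * (1 - a))
    (hε : 720 * ε ≤ gain (a * (1 - a))) (k : ℕ) :
    (observe μ t a ^ k) (potential a (gain (a * (1 - a)))) a ≤ (a * (1 - a)) ^ 2 := by
  have hτ1 := sum_mul_sq_le h
  have hτ0 : 0 ≤ ∑ s, μ s * t s ^ 2 :=
    Finset.sum_nonneg fun s _ => mul_nonneg (h.nonneg s) (sq_nonneg _)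
  have hq4 : a * (1 - a) ≤ 1 / 4 := by nlinarith [sq_nonneg (a - 1 / 2)]
  have hstep := fun p hp => observe_potential_le h hq hε (p := p) hp
  set τ := ∑ s, μ s * t s ^ 2
  set q := a * (1 - a)
  set c := gain q with hc
  have hc0 : 0 < c := gain_pos hq
  set A := 9 * q - 1 - 3 * c
  induction k with
  | zero => simp [potential, q]
  | succ k ih =>
    rw [pow_succ, Module.End.mul_apply]
    have h1 : (observe μ t a ^ k) (observe μ t a (potential a c)) a
        ≤ (observe μ t a ^ k) ((1 - A * τ) • potential a c + (A * τ * q ^ 2) • fun _ => 1) a := by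
      refine observe_pow_mono h (fun p hp => (hstep p hp).trans (le_of_eq ?_)) k a h.prior
      simp only [Pi.add_apply, Pi.smul_apply, smul_eq_mul]
      ring
    refine h1.trans ?_
    rw [map_add, map_smul, map_smul, observe_pow_one h]
    simp only [Pi.add_apply, Pi.smul_apply, smul_eq_mul]
    have hA : A * τ ≤ 1 := by
      have : A ≤ 2 := by simp only [A]; linarith
      nlinarith
    linarith [mul_le_mul_of_nonneg_left ih (sub_nonneg.2 hA)]

theorem observe_deviation_sq_le (h : IsObservation μ t a ε) {c : ℝ}
    (hε : 4 * ε ≤ c) {p : ℝ} (hp : p ∈ Set.Icc (0 : ℝ) 1) :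
    observe μ t a (fun p => (p - a) ^ 2) p ≤ (1 - c / 2 * ∑ s, μ s * t s ^ 2) * (p - a) ^ 2
      + (∑ s, μ s * t s ^ 2) * potential a c p
      - (a * (1 - a)) ^ 2 * (∑ s, μ s * t s ^ 3) * (p - a) := by
  have h1 : observe μ t a (fun p => (p - a) ^ 2) p
      ≤ ∑ s, (μ s * ((p - a) ^ 2 + ((p - a) ^ 2 * (p - a) + 2 * (p - a) * (p * (1 - p))) * t s
        + ((p * (1 - p)) ^ 2 + c / 2 * (p - a) ^ 2) * t s ^ 2)
        - (a * (1 - a)) ^ 2 * (p - a) * (μ s * t s ^ 3)) := by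
    rw [observe_apply]
    refine Finset.sum_le_sum fun s _ => ?_
    have e1 := weighted_deviation_sq_le h.prior hp (h.abs_le_half s)
    have e2 := abs_mul_sq_le h s
    have e3 : 2 * (p - a) ^ 2 * (|t s| * t s ^ 2) ≤ c / 2 * (p - a) ^ 2 * t s ^ 2 := by
      have : 2 * (|t s| * t s ^ 2) ≤ c / 2 * t s ^ 2 := by nlinarith [sq_nonneg (t s)]
      have := mul_le_mul_of_nonneg_left this (sq_nonneg (p - a))
      linarith
    have := mul_le_mul_of_nonneg_left (e1.trans (add_le_add_right e3 _)) (h.nonneg s)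
    refine this.trans (le_of_eq ?_)
    ring
  refine h1.trans (le_of_eq ?_)
  rw [Finset.sum_sub_distrib, sum_quadratic h, ← Finset.mul_sum, potential]
  ring

theorem observe_pow_deviation_sq_nonneg (h : IsObservation μ t a ε) (k : ℕ) :
    0 ≤ (observe μ t a ^ k) (fun p => (p - a) ^ 2) a := by
  have := observe_pow_mono h (F := 0) (G := fun p => (p - a) ^ 2)
    (fun p _ => sq_nonneg _) k a h.prior
  simpa using this

/-- After `k + 2` observations of strength `τ = ∑ μ t ^ 2`, the mean squared deviation of the belief
is at most `(k + 2) q ^ 2 τ`, with a strict gain of order `τ ^ 2`. The first observation,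
made at deviation zero, brings no gain, which is why there are at least two. -/
theorem observe_pow_deviation_sq_le (h : IsObservation μ t a ε) (hq : 1 / 6 < a * (1 - a))
    (hε : 720 * ε ≤ gain (a * (1 - a))) (k : ℕ) :
    (observe μ t a ^ (k + 2)) (fun p => (p - a) ^ 2) a ≤ (a * (1 - a)) ^ 2 *
      ((k + 2) * (∑ s, μ s * t s ^ 2)
        - gain (a * (1 - a)) / 2 * (∑ s, μ s * t s ^ 2) ^ 2) := by
  have hτ1 := sum_mul_sq_le h
  have hτ0 : 0 ≤ ∑ s, μ s * t s ^ 2 :=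
    Finset.sum_nonneg fun s _ => mul_nonneg (h.nonneg s) (sq_nonneg _)
  have hε4 : 4 * ε ≤ gain (a * (1 - a)) := by
    have : 0 ≤ ε := by
      by_contra hneg
      have : IsEmpty S := ⟨fun s => by linarith [h.abs_le s, abs_nonneg (t s)]⟩
      simpa using h.sum_eq_one
    linarith
  have hq4 : a * (1 - a) ≤ 1 / 4 := by nlinarith [sq_nonneg (a - 1 / 2)]
  have hpot := observe_pow_potential_le h hq hε
  have hstep := fun p hp => observe_deviation_sq_le h hε4 (p := p) hp
  have hpos := observe_pow_deviation_sq_nonneg h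
  set τ := ∑ s, μ s * t s ^ 2
  set y := ∑ s, μ s * t s ^ 3
  set q := a * (1 - a)
  set c := gain q with hc
  have hc0 : 0 < c := gain_pos hq
  have hc1 : c ≤ 1 := by rw [hc, gain]; nlinarith
  have hrec : ∀ k, (observe μ t a ^ (k + 1)) (fun p => (p - a) ^ 2) a
      ≤ (1 - c / 2 * τ) * (observe μ t a ^ k) (fun p => (p - a) ^ 2) a + τ * q ^ 2 := by
    intro k
    rw [pow_succ, Module.End.mul_apply]
    have h1 : (observe μ t a ^ k) (observe μ t a fun p => (p - a) ^ 2) a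
        ≤ (observe μ t a ^ k) ((1 - c / 2 * τ) • (fun p => (p - a) ^ 2) + τ • potential a c
          - (q ^ 2 * y) • fun p => p - a) a :=
      observe_pow_mono h (fun p hp => hstep p hp) k a h.prior
    refine h1.trans ?_
    rw [map_sub, map_add, map_smul, map_smul, map_smul]
    simp only [Pi.add_apply, Pi.sub_apply, Pi.smul_apply, smul_eq_mul, observe_pow_deviation h]
    have := mul_le_mul_of_nonneg_left (hpot k) hτ0
    linarith
  have h0 : (observe μ t a ^ 0) (fun p => (p - a) ^ 2) a = 0 := by simp
  induction k with
  | zero =>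
    have h1 := hrec 0
    have h2 := hrec 1
    rw [h0] at h1
    have : (1 - c / 2 * τ) * (observe μ t a ^ (0 + 1)) (fun p => (p - a) ^ 2) a
        ≤ (1 - c / 2 * τ) * ((1 - c / 2 * τ) * 0 + τ * q ^ 2) :=
      mul_le_mul_of_nonneg_left h1 (by nlinarith)
    simp only [Nat.cast_zero, zero_add] at *
    linarith
  | succ k ih =>
    have h1 := hrec (k + 2)
    have h2 : 0 ≤ c / 2 * τ * (observe μ t a ^ (k + 2)) (fun p => (p - a) ^ 2) a :=
      mul_nonneg (by positivity) (hpos _)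
    rw [show k + 1 + 2 = k + 2 + 1 by ring]
    push_cast
    linarith

end Posterior

/-! ### Decomposition of the tree at the root -/

section Tree

variable {S : Type*} [Fintype S]

theorem parent_cons {d n : ℕ} (c : Fin d) (w : Level d (n + 1)) :
    parent (Fin.cons c w : Level d (n + 2)) = (Fin.cons c (parent w) : Level d (n + 1)) := by
  ext j
  refine Fin.cases ?_ (fun k => ?_) j
  · rfl
  · simp [parent, Fin.init]

/-- A vertex of generation `n + 1` as a child of the root and a vertex of its subtree. -/
def levelSplit (d n : ℕ) : Fin d × Level d n ≃ Level d (n + 1) := Fin.consEquiv fun _ => Fin d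

/-- The spins of generation `n + 1` as a family of spins in the subtrees of the root's children. -/
def spinsSplit (C : Type*) (d n : ℕ) : (Level d (n + 1) → C) ≃ (Fin d → Level d n → C) :=
  ((levelSplit d n).arrowCongr (Equiv.refl C)).symm.trans (Equiv.curry (Fin d) (Level d n) C)

theorem spinsSplit_apply {C : Type*} {d n : ℕ} (A : Level d (n + 1) → C) (c : Fin d)
    (w : Level d n) : spinsSplit C d n A c w = A (Fin.cons c w : Level d (n + 1)) := rfl

theorem sum_prod_spinsSplit {C : Type*} [Fintype C] {d n : ℕ} (F : Fin d → (Level d n → C) → ℝ) :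
    ∑ B : Level d (n + 1) → C, ∏ c, F c (spinsSplit C d n B c) = ∏ c, ∑ B, F c B := by
  rw [Fintype.prod_sum]
  exact (spinsSplit C d n).sum_comp fun x : Fin d → Level d n → C => ∏ c, F c (x c)

theorem prod_level_succ {d n : ℕ} (f : Level d (n + 1) → ℝ) :
    ∏ v, f v = ∏ c, ∏ w : Level d n, f (Fin.cons c w : Level d (n + 1)) := by
  rw [← (levelSplit d n).prod_comp, Fintype.prod_prod_type]
  rfl

/-- The recursion for the law at the root: given the spin of the root, the subtrees of its children
are independent. The definition of `levelLaw` recurses at the leaves instead. -/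
theorem levelLaw_succ_root {C : Type*} [Fintype C] [DecidableEq C] (M : Matrix C C ℝ) (d : ℕ)
    (i : C) (n : ℕ) (A : Level d (n + 1) → C) :
    levelLaw M d i (n + 1) A
      = ∏ c, ∑ j, M i j * levelLaw M d j n (spinsSplit C d n A c) := by
  induction n generalizing i with
  | zero =>
    have h : ∀ B : Level d 0 → C, ∀ v : Level d 1, B (parent v) = B Fin.elim0 :=
      fun B v => congrArg B (Subsingleton.elim _ _)
    have hs : ∀ b, M i b = ∑ j, M i j * if b = j then 1 else 0 := fun b => by simp
    simp only [levelLaw, h, ite_mul, one_mul, zero_mul, spinsSplit_apply]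
    rw [Finset.sum_eq_single (fun _ => i)]
    · rw [if_pos rfl, prod_level_succ]
      refine Finset.prod_congr rfl fun c _ => ?_
      rw [Fintype.prod_subsingleton _ Fin.elim0]
      exact hs _
    · intro B _ hB
      refine if_neg fun h0 => hB (funext fun v => ?_)
      rw [Subsingleton.elim v Fin.elim0, h0]
    · simp
  | succ n ih =>
    have h : ∀ B : Level d (n + 1) → C, (∏ v : Level d (n + 2), M (B (parent v)) (A v))
        = ∏ c, ∏ w : Level d (n + 1), M (spinsSplit C d n B c (parent w))
          (spinsSplit C d (n + 1) A c w) := by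
      intro B
      rw [prod_level_succ]
      simp only [parent_cons, spinsSplit_apply]
    rw [levelLaw.eq_2]
    refine (Finset.sum_congr rfl fun B _ => by
      rw [ih, h B, ← Finset.prod_mul_distrib]).trans ?_
    rw [sum_prod_spinsSplit fun c B => (∑ j, M i j * levelLaw M d j n B) *
      ∏ w : Level d (n + 1), M (B (parent w)) (spinsSplit C d (n + 1) A c w)]
    refine Finset.prod_congr rfl fun c _ => ?_
    simp only [Finset.sum_mul]
    rw [Finset.sum_comm]
    refine Finset.sum_congr rfl fun j _ => ?_
    rw [levelLaw.eq_2, Finset.mul_sum]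
    exact Finset.sum_congr rfl fun B _ => by ring

theorem levelLaw_nonneg {C : Type*} [Fintype C] [DecidableEq C] {M : Matrix C C ℝ}
    (hM : ∀ i j, 0 ≤ M i j) (d : ℕ) (i : C) (n : ℕ) (A : Level d n → C) :
    0 ≤ levelLaw M d i n A := by
  induction n with
  | zero => rw [levelLaw]; split_ifs <;> norm_num
  | succ n ih =>
    rw [levelLaw]
    exact Finset.sum_nonneg fun B _ => mul_nonneg (ih B) (Finset.prod_nonneg fun v _ => hM _ _)

theorem sum_levelLaw {C : Type*} [Fintype C] [DecidableEq C] {M : Matrix C C ℝ}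
    (hM : ∀ i, ∑ j, M i j = 1) (d : ℕ) (i : C) (n : ℕ) : ∑ A, levelLaw M d i n A = 1 := by
  induction n with
  | zero =>
    rw [Finset.sum_eq_single (fun _ => i)]
    · simp [levelLaw]
    · intro B _ hB
      refine if_neg fun h0 => hB (funext fun v => ?_)
      rw [Subsingleton.elim v Fin.elim0, h0]
    · simp
  | succ n ih =>
    simp only [levelLaw]
    rw [Finset.sum_comm]
    simp only [← Finset.mul_sum]
    rw [← ih]
    refine Finset.sum_congr rfl fun B _ => ?_
    rw [← Fintype.prod_sum fun (v : Level d (n + 1)) j => M (B (parent v)) j]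
    simp [hM]

/-! ### The chi-square distance and its recursion -/

/-- The chi-square distance of `f` and `g` relative to their mixture with weights `a` and `1 - a`.
Where the mixture of two nonnegative functions vanishes, both vanish (for `0 < a < 1`), and the
summand is `0 / 0 = 0`. -/
def chiSq (a : ℝ) (f g : S → ℝ) : ℝ := ∑ s, (f s - g s) ^ 2 / (a * f s + (1 - a) * g s)

theorem tvDist_sq_le {a : ℝ} (ha0 : 0 < a) (ha1 : a < 1) {f g : S → ℝ} (hf : ∀ s, 0 ≤ f s)
    (hg : ∀ s, 0 ≤ g s) (hf1 : ∑ s, f s = 1) (hg1 : ∑ s, g s = 1) :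
    tvDist f g ^ 2 ≤ chiSq a f g / 4 := by
  have hμ : ∀ s, 0 ≤ a * f s + (1 - a) * g s := fun s =>
    add_nonneg (mul_nonneg ha0.le (hf s)) (mul_nonneg (by linarith) (hg s))
  have h1 : (∑ s, |f s - g s|) ^ 2 ≤ chiSq a f g * ∑ s, (a * f s + (1 - a) * g s) := by
    refine Finset.sum_sq_le_sum_mul_sum_of_sq_le_mul _
      (fun s _ => div_nonneg (sq_nonneg _) (hμ s)) (fun s _ => hμ s) fun s _ => le_of_eq ?_
    rw [sq_abs]
    by_cases h : a * f s + (1 - a) * g s = 0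
    · have h2 : f s = 0 := by nlinarith [hf s, hg s]
      have h3 : g s = 0 := by nlinarith [hf s, hg s]
      simp [h2, h3]
    · rw [div_mul_cancel₀ _ h]
  have h2 : ∑ s, (a * f s + (1 - a) * g s) = 1 := by
    rw [Finset.sum_add_distrib, ← Finset.mul_sum, ← Finset.mul_sum, hf1, hg1]
    ring
  rw [h2, mul_one] at h1
  rw [tvDist, div_pow]
  linarith

/-- The powers of `observe` compute expectations over `k` independent observations: `u` and `v` are
the unnormalized weights of the two spins of the root, and `F` is evaluated at the posterior. -/
theorem sum_posterior (μ t : S → ℝ) (hμ : ∀ s, 0 ≤ μ s) {a : ℝ}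
    (ha : a ∈ Set.Icc (0 : ℝ) 1) (ht : ∀ s, |t s| ≤ 1 / 2) (F : ℝ → ℝ) (k : ℕ) {u v : ℝ}
    (hu : 0 ≤ u) (hv : 0 ≤ v) :
    ∑ x : Fin k → S, (u * (∏ c, μ (x c) * (1 + (1 - a) * t (x c)))
        + v * ∏ c, μ (x c) * (1 - a * t (x c)))
      * F (u * (∏ c, μ (x c) * (1 + (1 - a) * t (x c)))
        / (u * (∏ c, μ (x c) * (1 + (1 - a) * t (x c)))
          + v * ∏ c, μ (x c) * (1 - a * t (x c))))
      = (u + v) * (observe μ t a ^ k) F (u / (u + v)) := by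
  induction k generalizing u v with
  | zero => simp
  | succ k ih =>
    rw [← (Fin.consEquiv fun _ => S).sum_comp, Fintype.sum_prod_type]
    have h : ∀ s, 0 ≤ 1 + (1 - a) * t s ∧ 0 ≤ 1 - a * t s := fun s => by
      have h1 := weight_ge_half ha ⟨zero_le_one, le_rfl⟩ (ht s)
      have h2 := weight_ge_half ha ⟨le_rfl, zero_le_one⟩ (ht s)
      constructor <;> linarith
    have h1 := fun s => ih (mul_nonneg hu (mul_nonneg (hμ s) (h s).1))
      (mul_nonneg hv (mul_nonneg (hμ s) (h s).2))
    simp only [Fin.consEquiv, Equiv.coe_fn_mk, Fin.prod_univ_succ, Fin.cons_zero, Fin.cons_succ,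
      ← mul_assoc] at h1 ⊢
    simp only [h1]
    rw [pow_succ', Module.End.mul_apply, observe_apply, Finset.mul_sum]
    refine Finset.sum_congr rfl fun s _ => ?_
    rcases (add_nonneg hu hv).eq_or_lt with h0 | hN
    · have hu0 : u = 0 := by linarith
      have hv0 : v = 0 := by linarith
      simp [hu0, hv0]
    rcases (hμ s).eq_or_lt with h0 | hm
    · simp [← h0]
    have hp : u / (u + v) ∈ Set.Icc (0 : ℝ) 1 :=
      ⟨div_nonneg hu hN.le, (div_le_one hN).2 (by linarith)⟩
    have hw : 0 < 1 + (u / (u + v) - a) * t s := by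
      linarith [weight_ge_half ha hp (ht s)]
    have e1 : u * μ s * (1 + (1 - a) * t s) + v * μ s * (1 - a * t s)
        = (u + v) * (μ s * (1 + (u / (u + v) - a) * t s)) := by
      field_simp
      ring
    have e2 : u * μ s * (1 + (1 - a) * t s) / (u * μ s * (1 + (1 - a) * t s)
        + v * μ s * (1 - a * t s)) = bayes a (u / (u + v)) (t s) := by
      rw [e1, div_eq_iff (by positivity)]
      have := weight_mul_bayes hw.ne'
      calc u * μ s * (1 + (1 - a) * t s)
          = (u + v) * μ s * (u / (u + v) * (1 + (1 - a) * t s)) := by field_simp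
        _ = _ := by rw [← this]; ring
    rw [e2, e1]
    ring

theorem chiSq_prod (μ t : S → ℝ) (hμ : ∀ s, 0 ≤ μ s) {a : ℝ} (ha0 : 0 < a) (ha1 : a < 1)
    (ht : ∀ s, |t s| ≤ 1 / 2) (d : ℕ) :
    (a * (1 - a)) ^ 2 * chiSq a (fun x : Fin d → S => ∏ c, μ (x c) * (1 + (1 - a) * t (x c)))
        (fun x => ∏ c, μ (x c) * (1 - a * t (x c)))
      = (observe μ t a ^ d) (fun p => (p - a) ^ 2) a := by
  have h := sum_posterior μ t hμ ⟨ha0.le, ha1.le⟩ ht (fun p => (p - a) ^ 2) d ha0.le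
    (sub_pos.2 ha1).le
  rw [add_sub_cancel, one_mul, div_one] at h
  rw [← h, chiSq, Finset.mul_sum]
  refine Finset.sum_congr rfl fun x _ => ?_
  set P := ∏ c, μ (x c) * (1 + (1 - a) * t (x c))
  set Q := ∏ c, μ (x c) * (1 - a * t (x c))
  by_cases h0 : a * P + (1 - a) * Q = 0
  · simp [h0]
  · field_simp
    ring

/-- The recursion for the chi-square distance between the two conditional laws: `f` and `g` are the
laws in the subtree of a child, given the spin of the child. -/
theorem chiSq_children_le {a θ : ℝ} (hq : 1 / 6 < a * (1 - a))
    (hθ : 720 * (6 * |θ|) ≤ gain (a * (1 - a))) {f g : S → ℝ} (hf : ∀ s, 0 ≤ f s)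
    (hg : ∀ s, 0 ≤ g s) (hf1 : ∑ s, f s = 1) (hg1 : ∑ s, g s = 1) (k : ℕ) :
    chiSq a
      (fun x : Fin (k + 2) → S => ∏ c, ((a + θ * (1 - a)) * f (x c) + (1 - a) * (1 - θ) * g (x c)))
      (fun x => ∏ c, (a * (1 - θ) * f (x c) + (1 - a + θ * a) * g (x c)))
      ≤ (k + 2) * (θ ^ 2 * chiSq a f g)
        - gain (a * (1 - a)) / 2 * (θ ^ 2 * chiSq a f g) ^ 2 := by
  have ha0 : 1 / 6 < a := by nlinarith [sq_nonneg a]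
  have ha1 : a < 5 / 6 := by nlinarith [sq_nonneg (1 - a)]
  set μ : S → ℝ := fun s => a * f s + (1 - a) * g s with hμdef
  set t : S → ℝ := fun s => θ * ((f s - g s) / μ s) with htdef
  have hμ : ∀ s, 0 ≤ μ s := fun s =>
    add_nonneg (mul_nonneg (by linarith) (hf s)) (mul_nonneg (by linarith) (hg s))
  have hμt : ∀ s, μ s * t s = θ * (f s - g s) := by
    intro s
    by_cases h : μ s = 0
    · have h2 : f s = 0 := by simp only [hμdef] at h; nlinarith [hf s, hg s]
      have h3 : g s = 0 := by simp only [hμdef] at h; nlinarith [hf s, hg s]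
      simp [h, h2, h3]
    · simp only [htdef]
      field_simp
  have hμt2 : ∑ s, μ s * t s ^ 2 = θ ^ 2 * chiSq a f g := by
    rw [chiSq, Finset.mul_sum]
    refine Finset.sum_congr rfl fun s _ => ?_
    rw [sq (t s), ← mul_assoc, hμt]
    simp only [htdef, hμdef]
    ring
  have hobs : IsObservation μ t a (6 * |θ|) := by
    refine ⟨⟨by linarith, by linarith⟩, hμ, ?_, ?_, fun s => ?_, ?_⟩
    · simp only [hμdef]
      rw [Finset.sum_add_distrib, ← Finset.mul_sum, ← Finset.mul_sum, hf1, hg1]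
      ring
    · simp only [hμt]
      rw [← Finset.mul_sum, Finset.sum_sub_distrib, hf1, hg1]
      ring
    · have h1 : |f s - g s| ≤ 6 * μ s := by
        have := hf s
        have := hg s
        rw [abs_le]
        simp only [hμdef]
        constructor <;> nlinarith
      simp only [htdef]
      rw [abs_mul, abs_div, abs_of_nonneg (hμ s), mul_comm 6 |θ|]
      exact mul_le_mul_of_nonneg_left (div_le_of_le_mul₀ (hμ s) (by norm_num) h1) (abs_nonneg θ)
    · have hq4 : a * (1 - a) ≤ 1 / 4 := by nlinarith [sq_nonneg (a - 1 / 2)]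
      have : gain (a * (1 - a)) ≤ 1 := by
        rw [gain]
        nlinarith
      linarith
  have e1 : ∀ s, (a + θ * (1 - a)) * f s + (1 - a) * (1 - θ) * g s
      = μ s * (1 + (1 - a) * t s) := fun s => by
    rw [mul_add (μ s), mul_left_comm, hμt]
    simp only [hμdef]
    ring
  have e2 : ∀ s, a * (1 - θ) * f s + (1 - a + θ * a) * g s
      = μ s * (1 - a * t s) := fun s => by
    rw [mul_sub (μ s), mul_left_comm, hμt]
    simp only [hμdef]
    ring
  simp only [e1, e2]
  have h1 := chiSq_prod μ t hμ (by linarith) (by linarith : a < 1) hobs.abs_le_half (k + 2)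
  have h2 := observe_pow_deviation_sq_le hobs hq hθ k
  rw [← h1, hμt2] at h2
  exact le_of_mul_le_mul_left h2 (by positivity)

end Tree

/-! ### The binary channel -/

section Channel

/-- For `θ = 0` the recursion gives `x (n + 1) ≤ 0`; otherwise the subtracted square excludes every
positive limit of the decreasing sequence `x`. -/
theorem tendsto_zero_of_le_sub_sq {x : ℕ → ℝ} {d θ κ : ℝ} (hx : ∀ n, 0 ≤ x n)
    (hd : d * θ ^ 2 ≤ 1) (hκ : 0 < κ)
    (hrec : ∀ n, x (n + 1) ≤ d * (θ ^ 2 * x n) - κ * (θ ^ 2 * x n) ^ 2) :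
    Tendsto x atTop (nhds 0) := by
  have hanti : Antitone x := by
    refine antitone_nat_of_succ_le fun n => (hrec n).trans ?_
    have : 0 ≤ κ * (θ ^ 2 * x n) ^ 2 := by positivity
    nlinarith [hx n]
  have hconv := tendsto_atTop_ciInf hanti ⟨0, by rintro _ ⟨n, rfl⟩; exact hx n⟩
  set L := ⨅ n, x n
  have hL : L ≤ d * (θ ^ 2 * L) - κ * (θ ^ 2 * L) ^ 2 := by
    refine le_of_tendsto_of_tendsto' (hconv.comp (tendsto_add_atTop_nat 1)) ?_ hrec
    exact ((hconv.const_mul _).const_mul _).sub (((hconv.const_mul _).pow 2).const_mul _)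
  have hL0 : 0 ≤ L := ge_of_tendsto' hconv hx
  have hL1 : L = 0 := by
    have h1 : κ * (θ ^ 2 * L) ^ 2 ≤ 0 := by nlinarith
    have h2 : (θ ^ 2 * L) ^ 2 = 0 := by
      apply le_antisymm _ (sq_nonneg _)
      by_contra h
      nlinarith [mul_pos hκ (not_le.1 h)]
    have h3 : θ ^ 2 * L = 0 := by simpa using h2
    rw [h3] at hL
    linarith
  rwa [hL1] at hconv

/-- The channel in terms of its stationary distribution: `M = θ I + (1 - θ) 1 π`. The bound on the
asymmetry `Δ = (1 - θ) (1 - 2 π₁)` says that `6 π₁ π₂ > 1`. -/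
theorem binaryChannel_of_isStationary {π : Fin 2 → ℝ} {θ Δ : ℝ}
    (hΔ : Δ ^ 2 < (1 - θ) ^ 2 / 3) (hπ : IsStationary π (binaryChannel θ Δ)) :
    1 / 6 < π 0 * (1 - π 0) ∧
    binaryChannel θ Δ = !![π 0 + θ * (1 - π 0), (1 - π 0) * (1 - θ);
      π 0 * (1 - θ), 1 - π 0 + θ * π 0] := by
  obtain ⟨⟨-, hsum⟩, hst⟩ := hπ
  rw [Fin.sum_univ_two] at hsum
  have h0 := congrFun hst 0
  simp [Matrix.vecMul, dotProduct, Fin.sum_univ_two, binaryChannel] at h0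
  have h1 : π 1 = 1 - π 0 := by linarith
  rw [h1] at h0
  have h2 : Δ = (1 - θ) * (1 - 2 * π 0) := by linarith
  constructor
  · rw [h2, mul_pow] at hΔ
    have h3 : (1 - 2 * π 0) ^ 2 < 1 / 3 := by
      refine lt_of_mul_lt_mul_left (a := (1 - θ) ^ 2) ?_ (sq_nonneg _)
      linarith
    nlinarith
  · ext i j
    fin_cases i <;> fin_cases j <;> simp [binaryChannel, h2] <;> ring

theorem binaryChannel_nonneg {θ Δ : ℝ} (h : |θ| + |Δ| ≤ 1) (i j : Fin 2) :
    0 ≤ binaryChannel θ Δ i j := by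
  have h1 := abs_le.1 (le_refl |θ|)
  have h2 := abs_le.1 (le_refl |Δ|)
  fin_cases i <;> fin_cases j <;> simp [binaryChannel] <;> linarith

theorem sum_binaryChannel (θ Δ : ℝ) (i : Fin 2) : ∑ j, binaryChannel θ Δ i j = 1 := by
  fin_cases i <;> simp [binaryChannel, Fin.sum_univ_two] <;> ring

theorem tvDist_comm {S : Type*} [Fintype S] (p q : S → ℝ) : tvDist p q = tvDist q p := by
  simp only [tvDist, abs_sub_comm]

theorem nonReconstruction_of_le_one {π : Fin 2 → ℝ} {d : ℕ} {θ Δ : ℝ} (hθΔ : |θ| + |Δ| ≤ 1)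
    (hΔ : Δ ^ 2 < (1 - θ) ^ 2 / 3) (hπ : IsStationary π (binaryChannel θ Δ)) (hd2 : 2 ≤ d)
    (hθ : 720 * (6 * |θ|) ≤ gain (π 0 * (1 - π 0))) (hd : (d : ℝ) * θ ^ 2 ≤ 1) :
    NonReconstruction (binaryChannel θ Δ) d := by
  obtain ⟨hq, hM⟩ := binaryChannel_of_isStationary hΔ hπ
  have hnn := levelLaw_nonneg (binaryChannel_nonneg hθΔ) d
  have hsum := sum_levelLaw (sum_binaryChannel θ Δ) d
  set M := binaryChannel θ Δ
  set a := π 0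
  have ha0 : 0 < a := by nlinarith [sq_nonneg a]
  have ha1 : a < 1 := by nlinarith [sq_nonneg (1 - a)]
  set x : ℕ → ℝ := fun n => chiSq a (levelLaw M d 0 n) (levelLaw M d 1 n) with hx
  have hgain : 0 < gain (a * (1 - a)) := gain_pos hq
  obtain ⟨k, rfl⟩ := Nat.exists_eq_add_of_le' hd2
  have hxlim : Tendsto x atTop (nhds 0) := by
    refine tendsto_zero_of_le_sub_sq (d := (k + 2 : ℕ)) (θ := θ) (fun n => ?_) hd
      (half_pos hgain) fun n => ?_
    · exact Finset.sum_nonneg fun s _ => div_nonneg (sq_nonneg _)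
        (add_nonneg (mul_nonneg ha0.le (hnn _ _ _)) (mul_nonneg (by linarith) (hnn _ _ _)))
    · have h := chiSq_children_le hq hθ (hnn 0 n) (hnn 1 n) (hsum 0 n) (hsum 1 n) k
      push_cast
      refine le_trans (le_of_eq ?_) h
      simp only [hx, chiSq]
      rw [← (spinsSplit (Fin 2) (k + 2) n).sum_comp]
      refine Finset.sum_congr rfl fun A _ => ?_
      simp only [levelLaw_succ_root, Fin.sum_univ_two, hM]
      simp
  have htv : Tendsto (fun n => tvDist (levelLaw M (k + 2) 0 n) (levelLaw M (k + 2) 1 n))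
      atTop (nhds 0) := by
    have hsq : Tendsto (fun n => √(x n / 4)) atTop (nhds 0) := by
      simpa using (hxlim.div_const 4).sqrt
    refine squeeze_zero (fun n => ?_) (fun n => Real.le_sqrt_of_sq_le ?_) hsq
    · exact div_nonneg (Finset.sum_nonneg fun _ _ => abs_nonneg _) zero_le_two
    · exact tvDist_sq_le ha0 ha1 (hnn 0 n) (hnn 1 n) (hsum 0 n) (hsum 1 n)
  have hself : ∀ i, (fun n => tvDist (levelLaw M (k + 2) i n) (levelLaw M (k + 2) i n))
      = fun _ => 0 := fun i => by
    ext n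
    simp [tvDist]
  intro i j
  apply Tendsto.limsup_eq
  fin_cases i <;> fin_cases j
  · exact (hself 0).symm ▸ tendsto_const_nhds
  · exact htv
  · exact htv.congr fun n => tvDist_comm _ _
  · exact (hself 1).symm ▸ tendsto_const_nhds

end Channel

end TreeBroadcast

end

theorem theorem2 (π : Fin 2 → ℝ) :
    ∃ D : ℝ, 0 < D ∧ ∀ d : ℕ, D < (d : ℝ) →
      ∀ θ Δ : ℝ, |θ| + |Δ| ≤ 1 → Δ ^ 2 < (1 - θ) ^ 2 / 3 →
        TreeBroadcast.IsStationary π (TreeBroadcast.binaryChannel θ Δ) →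
          ((d : ℝ) * θ ^ 2 < 1 →
            TreeBroadcast.NonReconstruction (TreeBroadcast.binaryChannel θ Δ) d) ∧
          ((d : ℝ) * θ ^ 2 = 1 →
            TreeBroadcast.NonReconstruction (TreeBroadcast.binaryChannel θ Δ) d) := by
  set c := TreeBroadcast.gain (π 0 * (1 - π 0)) with hc
  -- `d θ² ≤ 1` and `d > (4320 / c)²` give `720 * (6 * |θ|) ≤ c`; the summand `2` ensures `d ≥ 2`
  refine ⟨(4320 / c) ^ 2 + 2, by positivity, fun d hd θ Δ hθΔ hΔ hπ => ?_⟩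
  suffices h : (d : ℝ) * θ ^ 2 ≤ 1 →
      TreeBroadcast.NonReconstruction (TreeBroadcast.binaryChannel θ Δ) d from
    ⟨fun h1 => h h1.le, fun h1 => h h1.le⟩
  intro hd1
  have hq := (TreeBroadcast.binaryChannel_of_isStationary hΔ hπ).1
  have hc0 : 0 < c := TreeBroadcast.gain_pos hq
  have hd2 : 2 ≤ d := by
    have : (2 : ℝ) < d := by linarith [sq_nonneg (4320 / c)]
    exact_mod_cast this.le
  refine TreeBroadcast.nonReconstruction_of_le_one hθΔ hΔ hπ hd2 ?_ hd1
  have h1 : (4320 / c * |θ|) ^ 2 ≤ 1 := by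
    rw [mul_pow, sq_abs]
    refine le_trans (mul_le_mul_of_nonneg_right ?_ (sq_nonneg θ)) hd1
    linarith
  have h2 : 4320 / c * |θ| ≤ 1 := by
    rw [sq_le_one_iff_abs_le_one] at h1
    exact (le_abs_self _).trans h1
  rw [div_mul_eq_mul_div, div_le_one hc0] at h2
  linarith
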